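/- Let $K$ be a field, let $n\ge 1$ be an integer, and let $\mathbb{S}_n=\mathbb{S}_n(K)$ be the algebra of one-sided inverses of the polynomial algebra $K[x_1,\dots,x_n]$, that is, the associative unital $K$-algebra generated by $2n$ elements $x_1,\dots,x_n,y_1,\dots,y_n$ subject to the defining relations $$y_ix_i=1\ \ (1\le i\le n),\qquad [x_i,y_j]=[x_i,x_j]=[y_i,y_j]=0\ \ (i\ne j),$$ where $[a,b]=ab-ba$. A module is called coherent if it is finitely generated and each of its finitely generated submodules is finitely presented; a ring $R$ is called left (resp. right) coherent if $R$ is coherent as a left (resp. right) module over itself. Then the following three conditions are equivalent: $\mathbb{S}_n$ is left coherent; $\mathbb{S}_n$ is right coherent; $n=1$. Moreover, if $n\ge 2$, then the left ideal $\{a\in\mathbb{S}_n : a(x_1-x_2)=0\}$, the kernel of right multiplication by $x_1-x_2$, is a direct sum of infinitely many (indexed by $\mathbb{N}$) nonzero left ideals of $\mathbb{S}_n$, and hence it is not finitely generated as a left ideal. -/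

import Mathlib

/-- The defining relations of the algebra of one-sided inverses, on the free algebra with
generators `x i` (the letters `Sum.inl i`) and `y i` (the letters `Sum.inr i`), `i : Fin n`. -/
inductive OneSidedInverseRel (K : Type*) [CommRing K] (n : ℕ) :
    FreeAlgebra K (Fin n ⊕ Fin n) → FreeAlgebra K (Fin n ⊕ Fin n) → Prop
  | y_mul_x (i : Fin n) : OneSidedInverseRel K n
      (FreeAlgebra.ι K (Sum.inr i) * FreeAlgebra.ι K (Sum.inl i)) 1
  | x_comm_y (i j : Fin n) (hij : i ≠ j) : OneSidedInverseRel K n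
      (FreeAlgebra.ι K (Sum.inl i) * FreeAlgebra.ι K (Sum.inr j))
      (FreeAlgebra.ι K (Sum.inr j) * FreeAlgebra.ι K (Sum.inl i))
  | x_comm_x (i j : Fin n) (hij : i ≠ j) : OneSidedInverseRel K n
      (FreeAlgebra.ι K (Sum.inl i) * FreeAlgebra.ι K (Sum.inl j))
      (FreeAlgebra.ι K (Sum.inl j) * FreeAlgebra.ι K (Sum.inl i))
  | y_comm_y (i j : Fin n) (hij : i ≠ j) : OneSidedInverseRel K n
      (FreeAlgebra.ι K (Sum.inr i) * FreeAlgebra.ι K (Sum.inr j))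
      (FreeAlgebra.ι K (Sum.inr j) * FreeAlgebra.ι K (Sum.inr i))

/-- The algebra `𝕊ₙ(K)` of one-sided inverses of the polynomial algebra `K[x₁, …, xₙ]`:
the `K`-algebra generated by `x₁, …, xₙ, y₁, …, yₙ` with the defining relations
`yᵢ xᵢ = 1` and `[xᵢ, yⱼ] = [xᵢ, xⱼ] = [yᵢ, yⱼ] = 0` for `i ≠ j`. -/
def OneSidedInverses (K : Type*) [CommRing K] (n : ℕ) : Type _ :=
  RingQuot (OneSidedInverseRel K n)

namespace OneSidedInverses

noncomputable instance instRing (K : Type*) [CommRing K] (n : ℕ) : Ring (OneSidedInverses K n) :=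
  inferInstanceAs (Ring (RingQuot (OneSidedInverseRel K n)))

noncomputable instance instAlgebra (K : Type*) [CommRing K] (n : ℕ) :
    Algebra K (OneSidedInverses K n) :=
  inferInstanceAs (Algebra K (RingQuot (OneSidedInverseRel K n)))

/-- The generator `xᵢ` of `𝕊ₙ(K)` (the index `i : Fin n` starts at `0`). -/
noncomputable def x (K : Type*) [CommRing K] {n : ℕ} (i : Fin n) : OneSidedInverses K n :=
  RingQuot.mkAlgHom K (OneSidedInverseRel K n) (FreeAlgebra.ι K (Sum.inl i))

/-- The generator `yᵢ` of `𝕊ₙ(K)` (the index `i : Fin n` starts at `0`). -/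
noncomputable def y (K : Type*) [CommRing K] {n : ℕ} (i : Fin n) : OneSidedInverses K n :=
  RingQuot.mkAlgHom K (OneSidedInverseRel K n) (FreeAlgebra.ι K (Sum.inr i))

end OneSidedInverses

/-- A (left) module `M` over a ring `R` is coherent if it is finitely generated and each of its
finitely generated submodules is finitely presented. -/
def IsCoherentModule (R M : Type*) [Ring R] [AddCommGroup M] [Module R M] : Prop :=
  Module.Finite R M ∧ ∀ N : Submodule R M, N.FG → Module.FinitePresentation R N

/-- A ring `R` is left coherent if the left module `R` over itself is coherent. -/
def IsLeftCoherentRing (R : Type*) [Ring R] : Prop :=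
  IsCoherentModule R R

/-- A ring `R` is right coherent if the right module `R` over itself is coherent; right
`R`-modules are modules over the opposite ring, which acts on `R` by right multiplication. -/
def IsRightCoherentRing (R : Type*) [Ring R] : Prop :=
  IsCoherentModule Rᵐᵒᵖ R

/-- The kernel of right multiplication by `r`, that is `{a ∈ R | a * r = 0}`, as a left ideal. -/
def kerMulRight (R : Type*) [Ring R] (r : R) : Submodule R R where
  carrier := {a | a * r = 0}
  add_mem' := by
    intro a b ha hb
    have ha' : a * r = 0 := ha
    have hb' : b * r = 0 := hb
    simp [add_mul, ha', hb']
  zero_mem' := by simp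
  smul_mem' := by
    intro c a ha
    have ha' : a * r = 0 := ha
    simp [mul_assoc, ha']

/-! Exchanging `xᵢ` and `yᵢ` is an anti-automorphism of `𝕊ₙ`, so left and right coherence agree.

For `n = 1`, multiplying a finitely generated left ideal `I` on the right by a high power of `x`
moves its generators into the principal ideal domain `K[x]`, so `I x ^ m` is generated by a single
polynomial. Powers of `x` can be stripped from this polynomial because `y x = 1`, and a polynomial
with nonzero constant term has zero left annihilator; hence `I x ^ m` is finitely presented. To
return to `I`, note that the kernel of `I → I x` lies in the minimal left ideal generated by `1 - x
y`, so it is zero or that whole ideal; in both cases it is finitely presented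
(`finitePresentation_of_map_toSpanSingleton`).

For `n ≥ 2`, coherence would make the left annihilator of `x₁ - x₂` finitely generated. Each of its
elements is killed by a power of `x₁` (`exists_mul_x_pow_eq_zero`), because `X - x₂` is monic in a
polynomial representation. Right multiplication by `x₁` and by `x₂` lowers the index of
`kernelElement` by one and kills index zero; so these elements lie in the annihilator, split it into
a direct sum, and need arbitrarily high powers of `x₁` to be killed. -/

/-! ### Transfer of finite presentation and coherence along semilinear equivalences. -/

section SemilinearTransfer

variable {R S M N : Type*} [Ring R] [Ring S] [AddCommGroup M] [AddCommGroup N]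
  [Module R M] [Module S N]

theorem Module.FinitePresentation.of_semilinearEquiv {σ : R →+* S} {σ' : S →+* R}
    [RingHomInvPair σ σ'] [RingHomInvPair σ' σ] (e : M ≃ₛₗ[σ] N)
    [Module.FinitePresentation R M] : Module.FinitePresentation S N := by
  obtain ⟨k, m, f, g, hf, hfg⟩ := Module.FinitePresentation.exists_fin' R M
  have hker : (LinearMap.ker f).FG := by
    rw [hfg.linearMap_ker_eq]
    exact Submodule.fg_range g
  let E : (Fin k → R) ≃ₛₗ[σ] (Fin k → S) :=
    { toFun := fun v i => σ (v i)
      invFun := fun w i => σ' (w i)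
      map_add' := fun v w => by ext; simp
      map_smul' := fun r v => by ext; simp
      left_inv := fun v => by ext; simp
      right_inv := fun w => by ext; simp }
  let l : (Fin k → S) →ₗ[S] N := (e.toLinearMap.comp f).comp E.symm.toLinearMap
  have hl : Function.Surjective l := e.surjective.comp (hf.comp E.symm.surjective)
  refine Module.finitePresentation_of_surjective l hl ?_
  have : LinearMap.ker l = (LinearMap.ker f).map E.toLinearMap := by
    ext w
    simp only [LinearMap.mem_ker, Submodule.mem_map]
    constructor
    · intro h
      exact ⟨E.symm w, e.injective (by simpa [l] using h), by simp⟩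
    · rintro ⟨v, hv, rfl⟩
      simp [l, hv]
  rw [this]
  exact hker.map _

theorem IsCoherentModule.of_semilinearEquiv {σ : R →+* S} {σ' : S →+* R}
    [RingHomInvPair σ σ'] [RingHomInvPair σ' σ] (e : M ≃ₛₗ[σ] N)
    (h : IsCoherentModule R M) : IsCoherentModule S N := by
  refine ⟨?_, fun L hL => ?_⟩
  · have := h.1
    exact Module.Finite.of_surjective e.toLinearMap e.surjective
  · have := h.2 (L.map e.symm.toLinearMap) (hL.map _)
    exact Module.FinitePresentation.of_semilinearEquiv (e.symm.submoduleMap L).symm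

end SemilinearTransfer

/-! ### Left annihilators and finite presentation of left ideals. -/

section KerMulRight

variable {R : Type*} [Ring R]

theorem mem_kerMulRight {r a : R} : a ∈ kerMulRight R r ↔ a * r = 0 := Iff.rfl

theorem ker_toSpanSingleton_eq_kerMulRight (r : R) :
    LinearMap.ker (LinearMap.toSpanSingleton R R r) = kerMulRight R r := by
  ext a
  simp [mem_kerMulRight]

/-- The left ideal `R r` is finitely presented by coherence, so the surjection `R → R r` has
finitely generated kernel. -/
theorem IsLeftCoherentRing.fg_kerMulRight (h : IsLeftCoherentRing R) (r : R) :
    (kerMulRight R r).FG := by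
  have := h.2 (LinearMap.range (LinearMap.toSpanSingleton R R r)) (Submodule.fg_range _)
  have h2 := Module.FinitePresentation.fg_ker (LinearMap.toSpanSingleton R R r).rangeRestrict
    (LinearMap.surjective_rangeRestrict _)
  rwa [LinearMap.ker_rangeRestrict, ker_toSpanSingleton_eq_kerMulRight] at h2

/-- A principal left ideal is finitely presented as soon as the left annihilator of its
generator is finitely generated. -/
theorem finitePresentation_span_singleton {r : R} (h : (kerMulRight R r).FG) :
    Module.FinitePresentation R (Submodule.span R {r}) := by
  rw [← ker_toSpanSingleton_eq_kerMulRight, ← LinearMap.ker_rangeRestrict] at h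
  rw [← LinearMap.range_toSpanSingleton]
  exact Module.finitePresentation_of_surjective _ (LinearMap.surjective_rangeRestrict _) h

variable {x y : R}

theorem kerMulRight_one_sub_eq_span (hyx : y * x = 1) :
    kerMulRight R (1 - x * y) = Submodule.span R {y} := by
  ext a
  rw [mem_kerMulRight, Submodule.mem_span_singleton]
  constructor
  · intro h
    rw [mul_sub, mul_one, sub_eq_zero, ← mul_assoc] at h
    exact ⟨a * x, h.symm⟩
  · rintro ⟨b, rfl⟩
    rw [smul_eq_mul, mul_assoc, mul_sub, ← mul_assoc y, hyx]
    simp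

/-- Let `y x = 1` and assume that the left ideal `R (1 - x y)` is minimal. A left ideal `I` is
finitely presented if `I x` is. -/
theorem finitePresentation_of_map_toSpanSingleton (hyx : y * x = 1)
    (hmin : ∀ s : R, s ≠ 0 → s * x = 0 → ∃ t, t * s = 1 - x * y) (I : Submodule R R)
    (h : Module.FinitePresentation R (I.map (LinearMap.toSpanSingleton R R x))) :
    Module.FinitePresentation R I := by
  have hker : Module.FinitePresentation R
      (LinearMap.ker ((LinearMap.toSpanSingleton R R x).submoduleMap I)) := by
    -- By minimality, one nonzero element of the kernel already forces `1 - x * y` into `I`, and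
    -- then the kernel is all of `R (1 - x y)`.
    by_cases hI : ∃ s ∈ I, s ≠ 0 ∧ s * x = 0
    · obtain ⟨s, hs, hs0, hsx⟩ := hI
      obtain ⟨t, ht⟩ := hmin s hs0 hsx
      have he : 1 - x * y ∈ I := ht ▸ I.smul_mem t hs
      have hex : (1 - x * y) * x = 0 := by rw [sub_mul, mul_assoc, hyx]; simp
      have := finitePresentation_span_singleton (r := 1 - x * y) (by
        rw [kerMulRight_one_sub_eq_span hyx]; exact Submodule.fg_span_singleton y)
      let f : Submodule.span R {1 - x * y} →ₗ[R] I :=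
        Submodule.inclusion ((Submodule.span_singleton_le_iff_mem _ _).2 he)
      have hf : ∀ a, f a ∈ LinearMap.ker ((LinearMap.toSpanSingleton R R x).submoduleMap I) := by
        rintro ⟨a, ha⟩
        obtain ⟨b, rfl⟩ := Submodule.mem_span_singleton.1 ha
        rw [LinearMap.mem_ker]
        ext
        simp [f, mul_assoc, hex]
      refine Module.FinitePresentation.of_equiv
        (LinearEquiv.ofBijective (f.codRestrict _ hf) ⟨?_, ?_⟩)
      · intro a b hab
        exact Submodule.inclusion_injective _ (congrArg Subtype.val hab)
      · rintro ⟨⟨a, haI⟩, ha⟩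
        have hax : a * x = 0 := congrArg Subtype.val (LinearMap.mem_ker.1 ha)
        refine ⟨⟨a, Submodule.mem_span_singleton.2 ⟨a, ?_⟩⟩, rfl⟩
        rw [smul_eq_mul, mul_sub, ← mul_assoc, hax]
        simp
    · push Not at hI
      have : Subsingleton (LinearMap.ker ((LinearMap.toSpanSingleton R R x).submoduleMap I)) := by
        rw [Submodule.subsingleton_iff_eq_bot, LinearMap.ker_eq_bot']
        rintro ⟨a, haI⟩ ha
        by_contra h0
        exact hI a haI (fun h => h0 (Subtype.ext h)) (congrArg Subtype.val ha)
      infer_instance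
  exact Module.finitePresentation_of_ker ((LinearMap.toSpanSingleton R R x).submoduleMap I)
    (LinearMap.submoduleMap_surjective _ _)

theorem finitePresentation_of_map_toSpanSingleton_pow (hyx : y * x = 1)
    (hmin : ∀ s : R, s ≠ 0 → s * x = 0 → ∃ t, t * s = 1 - x * y) (m : ℕ) (I : Submodule R R)
    (h : Module.FinitePresentation R (I.map (LinearMap.toSpanSingleton R R (x ^ m)))) :
    Module.FinitePresentation R I := by
  induction m generalizing I with
  | zero =>
    have : LinearMap.toSpanSingleton R R (x ^ 0) = LinearMap.id := by ext; simp
    rwa [this, Submodule.map_id] at h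
  | succ m ih =>
    refine finitePresentation_of_map_toSpanSingleton hyx hmin I (ih _ ?_)
    rw [← Submodule.map_comp]
    have : LinearMap.toSpanSingleton R R (x ^ m) ∘ₗ LinearMap.toSpanSingleton R R x =
        LinearMap.toSpanSingleton R R (x ^ (m + 1)) := by ext; simp [pow_succ']
    rwa [this]

end KerMulRight

/-! ### The annihilator of `x₁ - x₂` as an infinite direct sum. -/

section InfiniteSum

variable {R : Type*} [Ring R]

/-- The elements `(1 - x₁ y₁) (1 - x₂ y₂) ∑_{i + j = d} y₁ ^ i y₂ ^ j`. -/
def kernelElement (x₁ y₁ x₂ y₂ : R) (d : ℕ) : R :=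
  (1 - x₁ * y₁) * ((1 - x₂ * y₂) * ∑ i ∈ Finset.range (d + 1), y₁ ^ i * y₂ ^ (d - i))

variable {x₁ y₁ x₂ y₂ : R}

theorem kernelElement_zero : kernelElement x₁ y₁ x₂ y₂ 0 = (1 - x₁ * y₁) * (1 - x₂ * y₂) := by
  simp [kernelElement]

theorem one_sub_mul_mul_self (h : y₁ * x₁ = 1) : (1 - x₁ * y₁) * x₁ = 0 := by
  rw [sub_mul, mul_assoc, h]; simp

theorem one_sub_mul_idem (h : y₁ * x₁ = 1) : (1 - x₁ * y₁) * (1 - x₁ * y₁) = 1 - x₁ * y₁ := by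
  rw [mul_sub _ 1, ← mul_assoc, one_sub_mul_mul_self h]; simp

theorem kernelElement_zero_mul_left (h₁ : y₁ * x₁ = 1) (hxx : Commute x₁ x₂)
    (hxy : Commute x₁ y₂) : kernelElement x₁ y₁ x₂ y₂ 0 * x₁ = 0 := by
  have hc : Commute (1 - x₂ * y₂) x₁ := ((Commute.one_right _).sub_right (hxx.mul_right hxy)).symm
  rw [kernelElement_zero, mul_assoc, hc.eq, ← mul_assoc, one_sub_mul_mul_self h₁, zero_mul]

theorem kernelElement_zero_mul_right (h₂ : y₂ * x₂ = 1) :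
    kernelElement x₁ y₁ x₂ y₂ 0 * x₂ = 0 := by
  rw [kernelElement_zero, mul_assoc, one_sub_mul_mul_self h₂, mul_zero]

/-- Every term with a factor `y₁` loses one; the remaining term `x₁ * y₂ ^ (d + 1)` is killed by `1
- x₁ * y₁`. -/
theorem kernelElement_succ_mul_left (h₁ : y₁ * x₁ = 1) (hxx : Commute x₁ x₂)
    (hxy : Commute x₁ y₂) (d : ℕ) :
    kernelElement x₁ y₁ x₂ y₂ (d + 1) * x₁ = kernelElement x₁ y₁ x₂ y₂ d := by
  have hc : Commute (1 - x₂ * y₂) x₁ := ((Commute.one_right _).sub_right (hxx.mul_right hxy)).symm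
  have key : (∑ i ∈ Finset.range (d + 1 + 1), y₁ ^ i * y₂ ^ (d + 1 - i)) * x₁ =
      (∑ i ∈ Finset.range (d + 1), y₁ ^ i * y₂ ^ (d - i)) + x₁ * y₂ ^ (d + 1) := by
    rw [Finset.sum_range_succ', add_mul, Finset.sum_mul]
    congr 1
    · refine Finset.sum_congr rfl fun i _ => ?_
      rw [mul_assoc, ← (hxy.pow_right _).eq, ← mul_assoc, pow_succ, mul_assoc (y₁ ^ i), h₁,
        mul_one, Nat.add_sub_add_right]
    · simpa using (hxy.pow_right (d + 1)).eq.symm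
  rw [kernelElement, mul_assoc, mul_assoc, key, mul_add, mul_add, ← mul_assoc _ x₁, hc.eq,
    mul_assoc x₁, ← mul_assoc (1 - x₁ * y₁) x₁, one_sub_mul_mul_self h₁, zero_mul, add_zero,
    kernelElement]

theorem kernelElement_succ_mul_right (h₂ : y₂ * x₂ = 1) (hyx : Commute y₁ x₂)
    (hyy : Commute y₁ y₂) (d : ℕ) :
    kernelElement x₁ y₁ x₂ y₂ (d + 1) * x₂ = kernelElement x₁ y₁ x₂ y₂ d := by
  have hc : Commute (1 - x₂ * y₂) (y₁ ^ (d + 1)) :=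
    (((Commute.one_right y₁).sub_right (hyx.mul_right hyy)).pow_left _).symm
  have key : (∑ i ∈ Finset.range (d + 1 + 1), y₁ ^ i * y₂ ^ (d + 1 - i)) * x₂ =
      (∑ i ∈ Finset.range (d + 1), y₁ ^ i * y₂ ^ (d - i)) + y₁ ^ (d + 1) * x₂ := by
    rw [Finset.sum_range_succ, add_mul, Finset.sum_mul]
    congr 1
    · refine Finset.sum_congr rfl fun i hi => ?_
      have : d + 1 - i = d - i + 1 := by have := Finset.mem_range.1 hi; omega
      rw [this, pow_succ, mul_assoc, mul_assoc, h₂, mul_one]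
    · simp
  rw [kernelElement, mul_assoc, mul_assoc, key, mul_add, ← mul_assoc _ _ x₂, hc.eq,
    mul_assoc _ _ x₂, one_sub_mul_mul_self h₂, mul_zero, add_zero, kernelElement]

theorem kernelElement_mul_sub (h₁ : y₁ * x₁ = 1) (h₂ : y₂ * x₂ = 1) (hxx : Commute x₁ x₂)
    (hxy : Commute x₁ y₂) (hyx : Commute y₁ x₂) (hyy : Commute y₁ y₂) (d : ℕ) :
    kernelElement x₁ y₁ x₂ y₂ d * (x₁ - x₂) = 0 := by
  rw [mul_sub]
  cases d with
  | zero => rw [kernelElement_zero_mul_left h₁ hxx hxy, kernelElement_zero_mul_right h₂, sub_zero]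
  | succ d =>
    rw [kernelElement_succ_mul_left h₁ hxx hxy, kernelElement_succ_mul_right h₂ hyx hyy, sub_self]

theorem kernelElement_add_mul_pow (h₁ : y₁ * x₁ = 1) (hxx : Commute x₁ x₂) (hxy : Commute x₁ y₂)
    (d k : ℕ) : kernelElement x₁ y₁ x₂ y₂ (d + k) * x₁ ^ k = kernelElement x₁ y₁ x₂ y₂ d := by
  induction k with
  | zero => simp
  | succ k ih =>
    rw [← add_assoc, pow_succ', ← mul_assoc, kernelElement_succ_mul_left h₁ hxx hxy, ih]

theorem kernelElement_mul_pow_of_lt (h₁ : y₁ * x₁ = 1) (hxx : Commute x₁ x₂)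
    (hxy : Commute x₁ y₂) {d k : ℕ} (h : d < k) : kernelElement x₁ y₁ x₂ y₂ d * x₁ ^ k = 0 := by
  obtain ⟨j, rfl⟩ := Nat.exists_eq_add_of_lt h
  have := kernelElement_add_mul_pow h₁ hxx hxy 0 d
  rw [zero_add] at this
  rw [add_assoc, pow_add, ← mul_assoc, this, pow_succ', ← mul_assoc,
    kernelElement_zero_mul_left h₁ hxx hxy, zero_mul]

/-- This turns `a * kernelElement _ _ _ _ 0 = 0` into `a * kernelElement _ _ _ _ d = 0`, the
cancellation needed for independence. -/
theorem kernelElement_eq_zero_mul (h₁ : y₁ * x₁ = 1) (h₂ : y₂ * x₂ = 1) (hxx : Commute x₁ x₂)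
    (hxy : Commute x₁ y₂) (hyx : Commute y₁ x₂) (hyy : Commute y₁ y₂) (d : ℕ) :
    kernelElement x₁ y₁ x₂ y₂ 0 * kernelElement x₁ y₁ x₂ y₂ d = kernelElement x₁ y₁ x₂ y₂ d := by
  have hc : Commute (1 - x₂ * y₂) (1 - x₁ * y₁) :=
    (Commute.one_right _).sub_right ((Commute.one_left _).sub_left
      ((hxx.mul_left hyx).mul_right (hxy.mul_left hyy)).symm)
  rw [kernelElement_zero, kernelElement, mul_assoc, ← mul_assoc (1 - x₂ * y₂), hc.eq,
    mul_assoc (1 - x₁ * y₁), ← mul_assoc (1 - x₂ * y₂) (1 - x₂ * y₂), one_sub_mul_idem h₂,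
    ← mul_assoc (1 - x₁ * y₁) (1 - x₁ * y₁), one_sub_mul_idem h₁]

theorem iSupIndep_span_kernelElement (h₁ : y₁ * x₁ = 1) (h₂ : y₂ * x₂ = 1) (hxx : Commute x₁ x₂)
    (hxy : Commute x₁ y₂) (hyx : Commute y₁ x₂) (hyy : Commute y₁ y₂) :
    iSupIndep fun d => Submodule.span R {kernelElement x₁ y₁ x₂ y₂ d} := by
  rw [iSupIndep_iff_finsetSum_eq_zero_imp_eq_zero]
  intro s
  -- Multiplying a relation by `x₁ ^ D`, with `D` the largest index, kills all the other terms and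
  -- lowers the top one to index zero.
  induction s using Finset.induction_on_max with
  | empty => simp
  | insert D s hlt ih =>
    intro v hv hsum
    have hD : D ∉ s := fun h => lt_irrefl _ (hlt D h)
    rw [Finset.sum_insert hD] at hsum
    have hs : (∑ i ∈ s, v i) * x₁ ^ D = 0 := by
      rw [Finset.sum_mul]
      refine Finset.sum_eq_zero fun i hi => ?_
      obtain ⟨a, ha⟩ := Submodule.mem_span_singleton.1 (hv i (Finset.mem_insert_of_mem hi))
      rw [← ha, smul_eq_mul, mul_assoc, kernelElement_mul_pow_of_lt h₁ hxx hxy (hlt i hi), mul_zero]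
    obtain ⟨a, ha⟩ := Submodule.mem_span_singleton.1 (hv D (Finset.mem_insert_self _ _))
    have hDz : v D = 0 := by
      have h := congrArg (· * x₁ ^ D) hsum
      have h0 := kernelElement_add_mul_pow h₁ hxx hxy 0 D
      rw [zero_add] at h0
      simp only [add_mul, hs, add_zero, zero_mul, ← ha, smul_eq_mul, mul_assoc, h0] at h
      rw [← ha, smul_eq_mul, ← kernelElement_eq_zero_mul h₁ h₂ hxx hxy hyx hyy, ← mul_assoc, h,
        zero_mul]
    rw [hDz, zero_add] at hsum
    intro i hi
    rcases Finset.mem_insert.1 hi with rfl | hi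
    · exact hDz
    · exact ih v (fun i hi => hv i (Finset.mem_insert_of_mem hi)) hsum i hi

theorem iSup_span_kernelElement (h₁ : y₁ * x₁ = 1) (h₂ : y₂ * x₂ = 1) (hxx : Commute x₁ x₂)
    (hxy : Commute x₁ y₂) (hyx : Commute y₁ x₂) (hyy : Commute y₁ y₂)
    (hnil : ∀ a : R, a * (x₁ - x₂) = 0 → ∃ m : ℕ, a * x₁ ^ m = 0) :
    ⨆ d, Submodule.span R {kernelElement x₁ y₁ x₂ y₂ d} = kerMulRight R (x₁ - x₂) := by
  apply le_antisymm
  · refine iSup_le fun d => ?_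
    rw [Submodule.span_singleton_le_iff_mem]
    exact kernelElement_mul_sub h₁ h₂ hxx hxy hyx hyy d
  · intro a ha
    obtain ⟨m, hm⟩ := hnil a ha
    induction m generalizing a with
    | zero =>
      rw [pow_zero, mul_one] at hm
      rw [hm]
      exact Submodule.zero_mem _
    | succ m ih =>
      -- The last nonvanishing power gives `c`, killed by both `x₁` and `x₂`; subtracting `c` times
      -- the element of index `m` leaves something that `x₁ ^ m` kills.
      set c := a * x₁ ^ m with hc
      have hc1 : c * x₁ = 0 := by rw [hc, mul_assoc, ← pow_succ, hm]
      have hc2 : c * x₂ = 0 := by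
        have hax : a * x₁ = a * x₂ := by
          rw [mem_kerMulRight, mul_sub, sub_eq_zero] at ha
          exact ha
        rw [hc, mul_assoc, (hxx.pow_left m).eq, ← mul_assoc, ← hax, mul_assoc, ← pow_succ', hm]
      have hck : c * kernelElement x₁ y₁ x₂ y₂ 0 = c := by
        rw [kernelElement_zero, ← mul_assoc, mul_sub c, ← mul_assoc, hc1, zero_mul, sub_zero, mul_one,
          mul_sub, ← mul_assoc, hc2, zero_mul, sub_zero, mul_one]
      have hmem : c * kernelElement x₁ y₁ x₂ y₂ m ∈
          ⨆ d, Submodule.span R {kernelElement x₁ y₁ x₂ y₂ d} :=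
        Submodule.mem_iSup_of_mem m (Submodule.mem_span_singleton.2 ⟨c, rfl⟩)
      have hker := kernelElement_mul_sub h₁ h₂ hxx hxy hyx hyy m
      have h0 := kernelElement_add_mul_pow h₁ hxx hxy 0 m
      rw [zero_add] at h0
      have := ih (a := a - c * kernelElement x₁ y₁ x₂ y₂ m)
        (by rw [mem_kerMulRight, sub_mul, mul_assoc c, hker, mem_kerMulRight.1 ha]; simp)
        (by rw [sub_mul, mul_assoc c, h0, hck, ← hc, sub_self])
      simpa using Submodule.add_mem _ this hmem

/-- A left ideal of elements killed by powers of `x` on the right is not finitely generated if no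
single power kills it. -/
theorem not_fg_of_unbounded {I : Submodule R R} {x : R} (hnil : ∀ a ∈ I, ∃ m : ℕ, a * x ^ m = 0)
    (hunb : ∀ m : ℕ, ∃ a ∈ I, a * x ^ m ≠ 0) : ¬ I.FG := by
  rintro ⟨s, rfl⟩
  have hle : ∃ m, Submodule.span R (s : Set R) ≤ kerMulRight R (x ^ m) := by
    choose! f hf using fun a (ha : a ∈ s) => hnil a (Submodule.subset_span ha)
    refine ⟨s.sup f, Submodule.span_le.2 fun a ha => ?_⟩
    obtain ⟨k, hk⟩ := Nat.exists_eq_add_of_le (Finset.le_sup (f := f) ha)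
    rw [SetLike.mem_coe, mem_kerMulRight, hk, pow_add, ← mul_assoc, hf a ha, zero_mul]
  obtain ⟨m, hm⟩ := hle
  obtain ⟨a, ha, h⟩ := hunb m
  exact h (hm ha)

end InfiniteSum

namespace OneSidedInverses

open Polynomial

/-! ### Relations, universal property and induction principles for `𝕊ₙ`. -/

section Basic

variable {K : Type*} [CommRing K] {n : ℕ}

theorem y_mul_x (i : Fin n) : y K i * x K i = 1 := by
  have h := RingQuot.mkAlgHom_rel K (OneSidedInverseRel.y_mul_x (K := K) i)
  rwa [map_mul, map_one] at h

theorem commute_x_x (i j : Fin n) : Commute (x K i) (x K j) := by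
  rcases eq_or_ne i j with rfl | hij
  · exact Commute.refl _
  · have h := RingQuot.mkAlgHom_rel K (OneSidedInverseRel.x_comm_x (K := K) i j hij)
    rwa [map_mul, map_mul] at h

theorem commute_y_y (i j : Fin n) : Commute (y K i) (y K j) := by
  rcases eq_or_ne i j with rfl | hij
  · exact Commute.refl _
  · have h := RingQuot.mkAlgHom_rel K (OneSidedInverseRel.y_comm_y (K := K) i j hij)
    rwa [map_mul, map_mul] at h

theorem commute_x_y {i j : Fin n} (hij : i ≠ j) : Commute (x K i) (y K j) := by
  have h := RingQuot.mkAlgHom_rel K (OneSidedInverseRel.x_comm_y (K := K) i j hij)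
  rwa [map_mul, map_mul] at h

section Lift

variable {A : Type*} [Ring A] [Algebra K A] (X Y : Fin n → A)
  (hYX : ∀ i, Y i * X i = 1) (hXY : ∀ i j, i ≠ j → X i * Y j = Y j * X i)
  (hXX : ∀ i j, i ≠ j → X i * X j = X j * X i) (hYY : ∀ i j, i ≠ j → Y i * Y j = Y j * Y i)

/-- The universal property of `𝕊ₙ`. -/
noncomputable def lift : OneSidedInverses K n →ₐ[K] A :=
  RingQuot.liftAlgHom K ⟨FreeAlgebra.lift K (Sum.elim X Y), by
    intro a b h
    cases h with
    | y_mul_x i => simpa using hYX i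
    | x_comm_y i j hij => simpa using hXY i j hij
    | x_comm_x i j hij => simpa using hXX i j hij
    | y_comm_y i j hij => simpa using hYY i j hij⟩

@[simp]
theorem lift_x (i : Fin n) : lift X Y hYX hXY hXX hYY (x K i) = X i := by
  rw [lift, x]
  exact (RingQuot.liftAlgHom_mkAlgHom_apply _ _ _ _).trans (by simp)

@[simp]
theorem lift_y (i : Fin n) : lift X Y hYX hXY hXX hYY (y K i) = Y i := by
  rw [lift, y]
  exact (RingQuot.liftAlgHom_mkAlgHom_apply _ _ _ _).trans (by simp)

end Lift

theorem left_induction {P : OneSidedInverses K n → Prop} (one : P 1)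
    (smul : ∀ (c : K) a, P a → P (c • a)) (add : ∀ a b, P a → P b → P (a + b))
    (x_mul : ∀ i a, P a → P (x K i * a)) (y_mul : ∀ i a, P a → P (y K i * a))
    (a : OneSidedInverses K n) : P a := by
  let π : FreeAlgebra K (Fin n ⊕ Fin n) →ₐ[K] OneSidedInverses K n :=
    RingQuot.mkAlgHom K (OneSidedInverseRel K n)
  have key : ∀ w, ∀ b, P b → P (π w * b) := by
    intro w
    induction w using FreeAlgebra.induction with
    | grade0 c =>
      intro b hb
      rw [AlgHom.commutes, ← Algebra.smul_def]
      exact smul c b hb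
    | grade1 l =>
      rcases l with i | i
      · exact x_mul i
      · exact y_mul i
    | mul u v hu hv =>
      intro b hb
      rw [map_mul, mul_assoc]
      exact hu _ (hv b hb)
    | add u v hu hv =>
      intro b hb
      rw [map_add, add_mul]
      exact add _ _ (hu b hb) (hv b hb)
  obtain ⟨w, rfl⟩ : ∃ w, π w = a := RingQuot.mkAlgHom_surjective K (OneSidedInverseRel K n) a
  have := key w 1 one
  rwa [mul_one] at this

@[elab_as_elim]
theorem gen_induction {P : OneSidedInverses K n → Prop}
    (algebraMap_mem : ∀ c : K, P (algebraMap K _ c))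
    (add : ∀ a b, P a → P b → P (a + b)) (mul : ∀ a b, P a → P b → P (a * b))
    (hx : ∀ i, P (x K i)) (hy : ∀ i, P (y K i)) (a : OneSidedInverses K n) : P a := by
  refine left_induction (by simpa using algebraMap_mem 1) (fun c a ha => ?_) add
    (fun i a => mul _ _ (hx i)) (fun i a => mul _ _ (hy i)) a
  rw [Algebra.smul_def]
  exact mul _ _ (algebraMap_mem c) ha

instance [Nontrivial K] : Nontrivial (OneSidedInverses K n) :=
  (lift (A := K) (K := K) (n := n) (fun _ => 1) (fun _ => 1) (by simp) (by simp) (by simp)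
    (by simp)).toRingHom.domain_nontrivial

end Basic

/-! ### The anti-automorphism and left-right symmetry. -/

section Involution

variable (K : Type*) [CommRing K] (n : ℕ)

open MulOpposite

/-- The anti-automorphism of `𝕊ₙ` that exchanges `xᵢ` and `yᵢ`, as a homomorphism to the opposite
algebra. -/
noncomputable def toOpposite : OneSidedInverses K n →ₐ[K] (OneSidedInverses K n)ᵐᵒᵖ :=
  lift (fun i => op (y K i)) (fun i => op (x K i))
    (fun i => by rw [← op_mul, y_mul_x, op_one])
    (fun i j hij => by rw [← op_mul, ← op_mul, (commute_x_y hij.symm).eq])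
    (fun i j _ => by rw [← op_mul, ← op_mul, (commute_y_y i j).eq])
    (fun i j _ => by rw [← op_mul, ← op_mul, (commute_x_x i j).eq])

theorem unop_toOpposite_unop_toOpposite (a : OneSidedInverses K n) :
    unop (toOpposite K n (unop (toOpposite K n a))) = a := by
  induction a using gen_induction with
  | algebraMap_mem c => simp [MulOpposite.algebraMap_apply]
  | add a b ha hb => simp [ha, hb]
  | mul a b ha hb => simp [ha, hb]
  | hx i => simp [toOpposite]
  | hy i => simp [toOpposite]

/-- The ring isomorphism from `𝕊ₙ` to its opposite that exchanges `xᵢ` and `yᵢ`. -/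
noncomputable def equivOpposite : OneSidedInverses K n ≃+* (OneSidedInverses K n)ᵐᵒᵖ :=
  { (toOpposite K n).toRingHom with
    invFun := fun a => unop (toOpposite K n (unop a))
    left_inv := fun a => unop_toOpposite_unop_toOpposite K n a
    right_inv := fun a => unop_injective (unop_toOpposite_unop_toOpposite K n (unop a)) }

theorem isLeftCoherentRing_iff_isRightCoherentRing :
    IsLeftCoherentRing (OneSidedInverses K n) ↔ IsRightCoherentRing (OneSidedInverses K n) := by
  let σ : OneSidedInverses K n →+* (OneSidedInverses K n)ᵐᵒᵖ := (equivOpposite K n).toRingHom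
  let σ' : (OneSidedInverses K n)ᵐᵒᵖ →+* OneSidedInverses K n := (equivOpposite K n).symm.toRingHom
  have : RingHomInvPair σ σ' := RingHomInvPair.of_ringEquiv (equivOpposite K n)
  have : RingHomInvPair σ' σ := RingHomInvPair.symm σ σ'
  let e : OneSidedInverses K n ≃ₛₗ[σ] OneSidedInverses K n :=
    { (equivOpposite K n).toAddEquiv.trans opAddEquiv.symm with
      map_smul' := fun r a => by
        simp [MulOpposite.smul_eq_mul_unop, σ] }
  exact ⟨IsCoherentModule.of_semilinearEquiv e, IsCoherentModule.of_semilinearEquiv e.symm⟩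

end Involution

/-! ### A polynomial representation and nilpotence of `xᵢ` on the annihilator. -/

section PolynomialRepresentation

variable (K : Type*) [CommRing K] {n : ℕ} (i : Fin n)

/-- The subalgebra of `𝕊ₙ` generated by all the `xⱼ` and by the `yⱼ` with `j ≠ i`. -/
noncomputable def adjoinExcept : Subalgebra K (OneSidedInverses K n) :=
  Algebra.adjoin K (Set.range (x K) ∪ y K '' {j | j ≠ i})

theorem x_mem_adjoinExcept (j : Fin n) : x K j ∈ adjoinExcept K i :=
  Algebra.subset_adjoin (Or.inl ⟨j, rfl⟩)

theorem y_mem_adjoinExcept {j : Fin n} (hj : j ≠ i) : y K j ∈ adjoinExcept K i :=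
  Algebra.subset_adjoin (Or.inr ⟨j, hj, rfl⟩)

variable {K i}

theorem commute_x_of_mem_adjoinExcept {b : OneSidedInverses K n} (hb : b ∈ adjoinExcept K i) :
    Commute b (x K i) := by
  refine Algebra.adjoin_induction (p := fun b _ => Commute b (x K i)) ?_
    (fun c => Algebra.commutes c _) (fun _ _ _ _ h h' => h.add_left h')
    (fun _ _ _ _ h h' => h.mul_left h') hb
  rintro _ (⟨j, rfl⟩ | ⟨j, hj, rfl⟩)
  · exact commute_x_x j i
  · exact (commute_x_y (Ne.symm hj)).symm

-- Elements of `adjoinExcept` commute with `xᵢ`, so each `yᵢ` on the left is cancelled by one more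
-- `xᵢ` on the right.
variable (i) in
theorem exists_mul_x_pow_mem_adjoinExcept (a : OneSidedInverses K n) :
    ∃ m : ℕ, a * x K i ^ m ∈ adjoinExcept K i := by
  have hx := x_mem_adjoinExcept K i
  induction a using left_induction with
  | one => exact ⟨0, by simp⟩
  | smul c a ha =>
    obtain ⟨m, hm⟩ := ha
    exact ⟨m, by rw [smul_mul_assoc]; exact Subalgebra.smul_mem _ hm c⟩
  | add a b ha hb =>
    obtain ⟨k, hk⟩ := ha
    obtain ⟨m, hm⟩ := hb
    refine ⟨k + m, ?_⟩
    rw [add_mul]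
    refine add_mem ?_ ?_
    · rw [pow_add, ← mul_assoc]
      exact mul_mem hk (pow_mem (hx i) m)
    · rw [add_comm, pow_add, ← mul_assoc]
      exact mul_mem hm (pow_mem (hx i) k)
  | x_mul j a ha =>
    obtain ⟨m, hm⟩ := ha
    exact ⟨m, by rw [mul_assoc]; exact mul_mem (hx j) hm⟩
  | y_mul j a ha =>
    obtain ⟨m, hm⟩ := ha
    by_cases hj : j = i
    · subst hj
      refine ⟨m + 1, ?_⟩
      rwa [pow_succ, ← mul_assoc, mul_assoc (y K j), mul_assoc,
        (commute_x_of_mem_adjoinExcept hm).eq, ← mul_assoc, y_mul_x, one_mul]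
    · exact ⟨m, by rw [mul_assoc]; exact mul_mem (y_mem_adjoinExcept K i hj) hm⟩

variable (K n) in
/-- `Polynomial.divX` as a linear map. -/
noncomputable def divXLinear : Module.End K (OneSidedInverses K n)[X] where
  toFun := divX
  map_add' _ _ := divX_add
  map_smul' c p := by ext; simp [coeff_divX]

variable (K i) in
/-- The action of `𝕊ₙ` on polynomials in one variable over `𝕊ₙ`: here `xᵢ` and `yᵢ` are the shift
`X * _` and the backward shift `divX`, and the other generators act by left multiplication on the
coefficients. -/
noncomputable def polyRep : OneSidedInverses K n →ₐ[K] Module.End K (OneSidedInverses K n)[X] :=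
  lift (fun j => if j = i then LinearMap.mulLeft K X else LinearMap.mulLeft K (C (x K j)))
    (fun j => if j = i then divXLinear K n else LinearMap.mulLeft K (C (y K j)))
    (fun j => by
      split_ifs
      · ext p k; simp [divXLinear, coeff_divX]
      · ext p k : 2
        simp only [Module.End.mul_apply, LinearMap.mulLeft_apply, ← mul_assoc, ← C_mul, y_mul_x,
          C_1, one_mul, Module.End.one_apply])
    (fun j k hjk => by
      split_ifs with hj hk hk
      · exact absurd (hj.trans hk.symm) hjk
      · ext p m : 2
        simp only [Module.End.mul_apply, LinearMap.mulLeft_apply, ← mul_assoc, X_mul_C]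
      · ext p m : 2
        simp [divXLinear, divX_C_mul]
      · ext p m : 2
        simp only [Module.End.mul_apply, LinearMap.mulLeft_apply, ← mul_assoc, ← C_mul,
          (commute_x_y hjk).eq])
    (fun j k hjk => by
      split_ifs with hj hk hk
      · rfl
      · ext p m : 2
        simp only [Module.End.mul_apply, LinearMap.mulLeft_apply, ← mul_assoc, X_mul_C]
      · ext p m : 2
        simp only [Module.End.mul_apply, LinearMap.mulLeft_apply, ← mul_assoc, X_mul_C]
      · ext p m : 2
        simp only [Module.End.mul_apply, LinearMap.mulLeft_apply, ← mul_assoc, ← C_mul,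
          (commute_x_x j k).eq])
    (fun j k hjk => by
      split_ifs with hj hk hk
      · rfl
      · ext p m : 2
        simp [divXLinear, divX_C_mul]
      · ext p m : 2
        simp [divXLinear, divX_C_mul]
      · ext p m : 2
        simp only [Module.End.mul_apply, LinearMap.mulLeft_apply, ← mul_assoc, ← C_mul,
          (commute_y_y j k).eq])

theorem polyRep_x_self (p : (OneSidedInverses K n)[X]) : polyRep K i (x K i) p = X * p := by
  simp [polyRep]

theorem polyRep_y_self (p : (OneSidedInverses K n)[X]) : polyRep K i (y K i) p = divX p := by
  simp [polyRep, divXLinear]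

theorem polyRep_x_of_ne {j : Fin n} (hj : j ≠ i) (p : (OneSidedInverses K n)[X]) :
    polyRep K i (x K j) p = C (x K j) * p := by
  simp [polyRep, hj]

theorem polyRep_y_of_ne {j : Fin n} (hj : j ≠ i) (p : (OneSidedInverses K n)[X]) :
    polyRep K i (y K j) p = C (y K j) * p := by
  simp [polyRep, hj]

/-- The elements of `adjoinExcept` act by left multiplication with a polynomial. -/
theorem polyRep_apply_of_mem_adjoinExcept {b : OneSidedInverses K n} (hb : b ∈ adjoinExcept K i)
    (p : (OneSidedInverses K n)[X]) : polyRep K i b p = polyRep K i b 1 * p := by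
  refine Algebra.adjoin_induction
    (p := fun b _ => ∀ p, polyRep K i b p = polyRep K i b 1 * p) ?_ ?_ ?_ ?_ hb p
  · rintro _ (⟨j, rfl⟩ | ⟨j, hj, rfl⟩) p
    · by_cases hj : j = i
      · subst hj
        simp [polyRep_x_self]
      · simp [polyRep_x_of_ne hj]
    · simp [polyRep_y_of_ne hj]
  · intro c p
    simp [Module.algebraMap_end_apply]
  · intro a b _ _ ha hb p
    simp only [map_add, LinearMap.add_apply, add_mul, ← ha, ← hb]
  · intro a b _ _ ha hb p
    simp only [map_mul, Module.End.mul_apply]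
    rw [ha, hb p, ha (polyRep K i b 1), mul_assoc]

variable (K i) in
/-- Evaluation of a polynomial at `xᵢ`, with the coefficients written on the right. -/
noncomputable def evalLeft : (OneSidedInverses K n)[X] →+ OneSidedInverses K n where
  toFun p := p.sum fun k a => x K i ^ k * a
  map_zero' := by simp
  map_add' p q := Polynomial.sum_add_index _ _ _ (by simp) (by simp [mul_add])

theorem evalLeft_monomial (k : ℕ) (a : OneSidedInverses K n) :
    evalLeft K i (monomial k a) = x K i ^ k * a :=
  sum_monomial_index _ _ (by simp)

theorem evalLeft_polyRep_of_mem_adjoinExcept {b : OneSidedInverses K n}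
    (hb : b ∈ adjoinExcept K i) (p : (OneSidedInverses K n)[X]) :
    evalLeft K i (polyRep K i b p) = b * evalLeft K i p := by
  have hC : ∀ {g : OneSidedInverses K n}, Commute g (x K i) → ∀ p : (OneSidedInverses K n)[X],
      evalLeft K i (C g * p) = g * evalLeft K i p := by
    intro g hg p
    induction p using Polynomial.induction_on' with
    | add p q hp hq => simp only [mul_add, map_add, hp, hq]
    | monomial k a =>
      rw [C_mul_monomial, evalLeft_monomial, evalLeft_monomial, ← mul_assoc, ← mul_assoc,
        (hg.pow_right k).eq]
  refine Algebra.adjoin_induction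
    (p := fun b _ => ∀ p, evalLeft K i (polyRep K i b p) = b * evalLeft K i p) ?_ ?_ ?_ ?_ hb p
  · rintro _ (⟨j, rfl⟩ | ⟨j, hj, rfl⟩) p
    · by_cases hj : j = i
      · subst hj
        rw [polyRep_x_self]
        induction p using Polynomial.induction_on' with
        | add p q hp hq => simp only [mul_add, map_add, hp, hq]
        | monomial k a =>
          rw [X_mul_monomial, evalLeft_monomial, evalLeft_monomial, pow_succ', mul_assoc]
      · rw [polyRep_x_of_ne hj, hC (commute_x_x j i)]
    · rw [polyRep_y_of_ne hj, hC (commute_x_y (Ne.symm hj)).symm]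
  · intro c p
    rw [AlgHom.commutes, Module.algebraMap_end_apply, ← hC (Algebra.commutes c _)]
    congr 1
    ext
    simp [Algebra.smul_def]
  · intro a b _ _ ha hb p
    simp only [map_add, LinearMap.add_apply, add_mul, ← ha, ← hb]
  · intro a b _ _ ha hb p
    rw [map_mul, Module.End.mul_apply, ha, hb, mul_assoc]

/-- Evaluation at `xᵢ` recovers `b` from the polynomial by which it acts. -/
theorem eq_zero_of_polyRep_one_eq_zero {b : OneSidedInverses K n} (hb : b ∈ adjoinExcept K i)
    (h : polyRep K i b 1 = 0) : b = 0 := by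
  have h1 : evalLeft K i (1 : (OneSidedInverses K n)[X]) = 1 := by
    rw [← C_1, ← monomial_zero_left, evalLeft_monomial]
    simp
  have := evalLeft_polyRep_of_mem_adjoinExcept hb 1
  rwa [h, map_zero, h1, mul_one, eq_comm] at this

/-- In the representation, `b` becomes a polynomial annihilated on the right by the monic `X - C (x
K j)`, which is not a zero divisor. -/
theorem eq_zero_of_mul_x_sub_x_eq_zero {j : Fin n} (hj : j ≠ i) {b : OneSidedInverses K n}
    (hb : b ∈ adjoinExcept K i) (h : b * (x K i - x K j) = 0) : b = 0 := by
  apply eq_zero_of_polyRep_one_eq_zero hb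
  have h1 : polyRep K i b (polyRep K i (x K i - x K j) 1) = 0 := by
    rw [← Module.End.mul_apply, ← map_mul, h, map_zero, LinearMap.zero_apply]
  rw [polyRep_apply_of_mem_adjoinExcept hb, map_sub, LinearMap.sub_apply, polyRep_x_self,
    polyRep_x_of_ne hj, mul_one, mul_one] at h1
  exact (monic_X_sub_C (x K j)).mul_left_eq_zero_iff.1 h1

theorem exists_mul_x_pow_eq_zero {j : Fin n} (hj : j ≠ i) {a : OneSidedInverses K n}
    (h : a * (x K i - x K j) = 0) : ∃ m : ℕ, a * x K i ^ m = 0 := by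
  obtain ⟨m, hm⟩ := exists_mul_x_pow_mem_adjoinExcept i a
  refine ⟨m, eq_zero_of_mul_x_sub_x_eq_zero hj hm ?_⟩
  rw [mul_assoc, (((Commute.refl (x K i)).sub_right (commute_x_x i j)).pow_left m).eq, ← mul_assoc,
    h, zero_mul]

theorem one_sub_x_mul_y_ne_zero [Nontrivial K] : 1 - x K i * y K i ≠ 0 := by
  intro h
  have := congrArg (fun a => polyRep K i a 1) h
  simp [polyRep_x_self, polyRep_y_self] at this

/-- The second factor sends `1` to the constant `C (1 - x K j * y K j)`, and the first fixes
constants because `divX` kills them. -/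
theorem one_sub_mul_one_sub_ne_zero [Nontrivial K] {j : Fin n} (hj : j ≠ i) :
    (1 - x K i * y K i) * (1 - x K j * y K j) ≠ 0 := by
  intro h
  have hC : polyRep K i (1 - x K j * y K j) 1 = C (1 - x K j * y K j) := by
    rw [map_sub, map_one (polyRep K i), map_mul, LinearMap.sub_apply, Module.End.mul_apply, polyRep_y_of_ne hj,
      polyRep_x_of_ne hj, mul_one, Module.End.one_apply, C_sub, C_mul, C_1]
  have h1 := congrArg (fun a => polyRep K i a 1) h
  simp only [map_mul (polyRep K i), Module.End.mul_apply, hC] at h1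
  rw [map_sub, map_one (polyRep K i), map_mul, LinearMap.sub_apply, Module.End.mul_apply, polyRep_y_self, divX_C,
    map_zero, sub_zero, Module.End.one_apply, map_zero, LinearMap.zero_apply, C_eq_zero] at h1
  exact one_sub_x_mul_y_ne_zero h1

end PolynomialRepresentation

/-! ### Left coherence of `𝕊₁`. -/

section OneVariable

variable {K : Type*} [Field K]

theorem adjoinExcept_eq_range_aeval (i : Fin 1) :
    adjoinExcept K i = (aeval (R := K) (x K i)).range := by
  have h : Set.range (x K) ∪ y K '' {j | j ≠ i} = {x K i} := by
    have h1 : {j : Fin 1 | j ≠ i} = ∅ := by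
      ext j
      simp [Subsingleton.elim j i]
    rw [h1, Set.image_empty, Set.union_empty, Set.range_unique, Subsingleton.elim i default]
  rw [adjoinExcept, h, Algebra.adjoin_singleton_eq_range_aeval]

theorem exists_mul_x_pow_eq_aeval {i : Fin 1} (a : OneSidedInverses K 1) :
    ∃ m : ℕ, a * x K i ^ m ∈ (aeval (R := K) (x K i)).range := by
  rw [← adjoinExcept_eq_range_aeval]
  exact exists_mul_x_pow_mem_adjoinExcept i a

/-- Sending every `x` to `X` and every `y` to `X⁻¹` maps `𝕊ₙ` to the rational functions, where
polynomials embed. -/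
theorem aeval_x_injective {n : ℕ} (i : Fin n) : Function.Injective (aeval (R := K) (x K i)) := by
  let f : OneSidedInverses K n →ₐ[K] RatFunc K :=
    lift (fun _ => RatFunc.X) (fun _ => RatFunc.X⁻¹)
      (fun _ => inv_mul_cancel₀ RatFunc.X_ne_zero) (fun _ _ _ => mul_comm _ _)
      (fun _ _ _ => mul_comm _ _) (fun _ _ _ => mul_comm _ _)
  refine Function.Injective.of_comp (f := f) ?_
  have : f ∘ aeval (x K i) = algebraMap K[X] (RatFunc K) := by
    ext p
    have h : f.comp (aeval (x K i)) = IsScalarTower.toAlgHom K K[X] (RatFunc K) := by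
      apply Polynomial.algHom_ext
      simp [f]
    exact DFunLike.congr_fun h p
  rw [this]
  exact FaithfulSMul.algebraMap_injective _ _

variable {i : Fin 1}

/-- Since `y (1 - x y) = 0`, `y` acts as the backward shift on `K[x] (1 - x y)`. Repeated shifts
bring any nonzero element down to its leading coefficient, whence minimality. -/
theorem y_mul_aeval_mul_one_sub {n : ℕ} (i : Fin n) (p : K[X]) :
    y K i * (aeval (x K i) p * (1 - x K i * y K i)) =
      aeval (x K i) (divX p) * (1 - x K i * y K i) := by
  have hy : y K i * (1 - x K i * y K i) = 0 := by
    rw [mul_sub, ← mul_assoc, y_mul_x]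
    simp
  conv_lhs => rw [← X_mul_divX_add p]
  rw [map_add, map_mul, aeval_X, aeval_C, add_mul, mul_add, ← mul_assoc (y K i) (algebraMap _ _ _),
    ← Algebra.commutes, mul_assoc (algebraMap _ _ _), hy, mul_zero, add_zero, mul_assoc (x K i),
    ← mul_assoc, y_mul_x, one_mul]

theorem exists_mul_aeval_mul_one_sub_eq {n : ℕ} (i : Fin n) {p : K[X]} (hp : p ≠ 0) :
    ∃ t, t * (aeval (x K i) p * (1 - x K i * y K i)) = 1 - x K i * y K i := by
  induction hd : p.natDegree generalizing p with
  | zero =>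
    rw [eq_C_of_natDegree_eq_zero hd] at hp ⊢
    refine ⟨algebraMap K _ (p.coeff 0)⁻¹, ?_⟩
    rw [aeval_C, ← mul_assoc, ← map_mul, inv_mul_cancel₀ (by simpa using hp), map_one, one_mul]
  | succ d ih =>
    have hdeg : (divX p).natDegree = d := by
      rw [natDegree_divX_eq_natDegree_tsub_one, hd, Nat.add_sub_cancel]
    obtain ⟨t, ht⟩ := ih (p := divX p) (by
      rw [Ne, divX_eq_zero_iff]
      intro h
      rw [h, natDegree_C] at hd
      omega) hdeg
    exact ⟨t * y K i, by rw [mul_assoc, y_mul_aeval_mul_one_sub, ht]⟩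

theorem exists_mul_one_sub_eq_aeval_mul (s : OneSidedInverses K 1) :
    ∃ p : K[X], s * (1 - x K i * y K i) = aeval (x K i) p * (1 - x K i * y K i) := by
  induction s using left_induction with
  | one => exact ⟨1, by simp⟩
  | smul c a ha =>
    obtain ⟨p, hp⟩ := ha
    exact ⟨c • p, by rw [smul_mul_assoc, hp, map_smul, smul_mul_assoc]⟩
  | add a b ha hb =>
    obtain ⟨p, hp⟩ := ha
    obtain ⟨q, hq⟩ := hb
    exact ⟨p + q, by rw [add_mul, hp, hq, map_add, add_mul]⟩
  | x_mul j a ha =>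
    obtain ⟨p, hp⟩ := ha
    obtain rfl := Subsingleton.elim j i
    exact ⟨X * p, by rw [mul_assoc, hp, map_mul, aeval_X, mul_assoc]⟩
  | y_mul j a ha =>
    obtain ⟨p, hp⟩ := ha
    obtain rfl := Subsingleton.elim j i
    exact ⟨divX p, by rw [mul_assoc, hp, y_mul_aeval_mul_one_sub]⟩

theorem exists_mul_eq_one_sub_of_mul_x_eq_zero (s : OneSidedInverses K 1) (hs : s ≠ 0)
    (hsx : s * x K i = 0) : ∃ t, t * s = 1 - x K i * y K i := by
  obtain ⟨p, hp⟩ := exists_mul_one_sub_eq_aeval_mul (i := i) s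
  have hse : s * (1 - x K i * y K i) = s := by
    rw [mul_sub, ← mul_assoc, hsx]
    simp
  rw [hse] at hp
  obtain ⟨t, ht⟩ := exists_mul_aeval_mul_one_sub_eq i (p := p) (by
    rintro rfl
    simp [hp] at hs)
  exact ⟨t, by rw [hp, ht]⟩

/-- If `s * x ^ (m + 1) = 0`, then `q` acts on `s * x ^ m` through its nonzero constant term alone,
so `s * x ^ m = 0` already. -/
theorem eq_zero_of_mul_aeval_eq_zero_of_mul_x_pow_eq_zero {n : ℕ} {i : Fin n} {q : K[X]}
    (hq : q.coeff 0 ≠ 0) {m : ℕ} {s : OneSidedInverses K n} (hs : s * aeval (x K i) q = 0)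
    (hsx : s * x K i ^ m = 0) : s = 0 := by
  induction m with
  | zero => simpa using hsx
  | succ m ih =>
    apply ih
    rw [pow_succ, ← mul_assoc] at hsx
    have h : s * x K i ^ m * aeval (x K i) q = 0 := by
      have hc : Commute (x K i ^ m) (aeval (x K i) q) := by
        have := Commute.map (Commute.all (X ^ m : K[X]) q) (aeval (x K i))
        rwa [map_pow, aeval_X] at this
      rw [mul_assoc, hc.eq, ← mul_assoc, hs, zero_mul]
    rw [← X_mul_divX_add q, map_add, map_mul, aeval_X, mul_add, ← mul_assoc, hsx, zero_mul,
      zero_add, aeval_C, ← Algebra.commutes, ← Algebra.smul_def] at h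
    exact (smul_eq_zero.1 h).resolve_left hq

theorem kerMulRight_aeval_eq_bot {q : K[X]} (hq : q.coeff 0 ≠ 0) :
    kerMulRight (OneSidedInverses K 1) (aeval (x K i) q) = ⊥ := by
  rw [eq_bot_iff]
  intro s hs
  obtain ⟨m, r, hr⟩ := exists_mul_x_pow_eq_aeval (i := i) s
  change aeval (x K i) r = s * x K i ^ m at hr
  refine eq_zero_of_mul_aeval_eq_zero_of_mul_x_pow_eq_zero hq hs (m := m) ?_
  have hrq : aeval (x K i) (r * q) = 0 := by
    have hc : Commute (x K i ^ m) (aeval (x K i) q) := by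
      have := Commute.map (Commute.all (X ^ m : K[X]) q) (aeval (x K i))
      rwa [map_pow, aeval_X] at this
    rw [map_mul, hr, mul_assoc, hc.eq, ← mul_assoc, mem_kerMulRight.1 hs, zero_mul]
  rw [map_eq_zero_iff _ (aeval_x_injective i)] at hrq
  rcases mul_eq_zero.1 hrq with h | h
  · rw [← hr, h, map_zero]
  · exact absurd (by simp [h]) hq

theorem finitePresentation_span_aeval (q : K[X]) :
    Module.FinitePresentation (OneSidedInverses K 1)
      (Submodule.span (OneSidedInverses K 1) {aeval (x K i) q}) := by
  by_cases hq : q = 0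
  · subst hq
    rw [map_zero, Submodule.span_zero_singleton]
    infer_instance
  · obtain ⟨p, hp, hdvd⟩ := exists_eq_pow_rootMultiplicity_mul_and_not_dvd q hq 0
    rw [map_zero, sub_zero] at hp hdvd
    have hspan : Submodule.span (OneSidedInverses K 1) {aeval (x K i) q} =
        Submodule.span (OneSidedInverses K 1) {aeval (x K i) p} := by
      rw [hp, map_mul, map_pow, aeval_X]
      apply le_antisymm <;> rw [Submodule.span_singleton_le_iff_mem, Submodule.mem_span_singleton]
      · exact ⟨_, rfl⟩
      · refine ⟨y K i ^ rootMultiplicity 0 q, ?_⟩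
        rw [smul_eq_mul, ← mul_assoc, pow_mul_pow_eq_one _ (y_mul_x i), one_mul]
    rw [hspan]
    apply finitePresentation_span_singleton
    rw [kerMulRight_aeval_eq_bot (by rwa [Ne, ← X_dvd_iff])]
    exact Submodule.fg_bot

/-- A left ideal of `𝕊₁` generated by polynomials in `x` is generated by a single one. -/
theorem exists_eq_span_aeval {I : Submodule (OneSidedInverses K 1) (OneSidedInverses K 1)}
    {s : Set (OneSidedInverses K 1)} (hI : I = Submodule.span _ s)
    (hs : ∀ a ∈ s, a ∈ (aeval (R := K) (x K i)).range) :
    ∃ q : K[X], I = Submodule.span _ {aeval (x K i) q} := by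
  -- The contraction of `I` along `K[X] → 𝕊₁`; its generator also generates `I`.
  let P : Ideal K[X] :=
    { carrier := {p | aeval (x K i) p ∈ I}
      add_mem' := fun {p q} hp hq => by
        rw [Set.mem_ofPred_eq, map_add]
        exact I.add_mem hp hq
      zero_mem' := by
        rw [Set.mem_ofPred_eq, map_zero]
        exact I.zero_mem
      smul_mem' := fun c p hp => by
        rw [Set.mem_ofPred_eq, smul_eq_mul, map_mul]
        exact I.smul_mem _ hp }
  obtain ⟨q, hq⟩ := (IsPrincipalIdealRing.principal P).principal
  have hqP : q ∈ P := by
    rw [hq]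
    exact Submodule.mem_span_singleton_self q
  refine ⟨q, le_antisymm ?_ ((Submodule.span_singleton_le_iff_mem _ _).2 hqP)⟩
  rw [hI, Submodule.span_le]
  intro a ha
  obtain ⟨p, rfl⟩ := hs a ha
  have hp : p ∈ P := by
    have := Submodule.subset_span (R := OneSidedInverses K 1) ha
    rwa [← hI] at this
  rw [hq] at hp
  obtain ⟨c, rfl⟩ := Submodule.mem_span_singleton.1 hp
  exact Submodule.mem_span_singleton.2 ⟨aeval (x K i) c, by simp⟩

theorem isLeftCoherentRing_one : IsLeftCoherentRing (OneSidedInverses K 1) := by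
  refine ⟨inferInstance, ?_⟩
  rintro I ⟨s, rfl⟩
  let i : Fin 1 := 0
  choose f hf using exists_mul_x_pow_eq_aeval (K := K) (i := i)
  -- The supremum of the exponents moves all generators into `K[x]` at once.
  refine finitePresentation_of_map_toSpanSingleton_pow (y_mul_x i)
    exists_mul_eq_one_sub_of_mul_x_eq_zero (s.sup f) _ ?_
  obtain ⟨q, hq⟩ := exists_eq_span_aeval (K := K) (i := i)
    (Submodule.map_span (LinearMap.toSpanSingleton (OneSidedInverses K 1) _ (x K i ^ s.sup f))
      (s : Set (OneSidedInverses K 1))) (by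
    rintro _ ⟨a, ha, rfl⟩
    obtain ⟨k, hk⟩ := Nat.exists_eq_add_of_le (Finset.le_sup (f := f) ha)
    rw [LinearMap.toSpanSingleton_apply, smul_eq_mul, hk, pow_add, ← mul_assoc]
    exact mul_mem (hf a)
      (pow_mem (show x K i ∈ (aeval (R := K) (x K i)).range from ⟨X, aeval_X _⟩) k))
  rw [hq]
  exact finitePresentation_span_aeval q

end OneVariable

/-! ### Failure of coherence for two or more variables. -/

section SeveralVariables

variable {K : Type*} [CommRing K] {n : ℕ} {i j : Fin n}

theorem iSupIndep_span_kernelElement (hij : i ≠ j) :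
    iSupIndep fun d => Submodule.span (OneSidedInverses K n)
      {kernelElement (x K i) (y K i) (x K j) (y K j) d} :=
  _root_.iSupIndep_span_kernelElement (y_mul_x i) (y_mul_x j) (commute_x_x i j) (commute_x_y hij)
    (commute_x_y hij.symm).symm (commute_y_y i j)

theorem iSup_span_kernelElement (hij : i ≠ j) :
    ⨆ d, Submodule.span (OneSidedInverses K n)
      {kernelElement (x K i) (y K i) (x K j) (y K j) d} = kerMulRight _ (x K i - x K j) :=
  _root_.iSup_span_kernelElement (y_mul_x i) (y_mul_x j) (commute_x_x i j) (commute_x_y hij)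
    (commute_x_y hij.symm).symm (commute_y_y i j) fun _ => exists_mul_x_pow_eq_zero hij.symm

theorem kernelElement_mul_x_pow_ne_zero [Nontrivial K] (hij : i ≠ j) (d : ℕ) :
    kernelElement (x K i) (y K i) (x K j) (y K j) d * x K i ^ d ≠ 0 := by
  have h := kernelElement_add_mul_pow (y_mul_x i) (commute_x_x i j) (commute_x_y (K := K) hij) 0 d
  rw [zero_add] at h
  rw [h, kernelElement_zero]
  exact one_sub_mul_one_sub_ne_zero hij.symm

theorem not_fg_kerMulRight_x_sub_x [Nontrivial K] (hij : i ≠ j) :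
    ¬ (kerMulRight (OneSidedInverses K n) (x K i - x K j)).FG :=
  not_fg_of_unbounded (fun _ => exists_mul_x_pow_eq_zero hij.symm) fun m =>
    ⟨_, kernelElement_mul_sub (y_mul_x i) (y_mul_x j) (commute_x_x i j) (commute_x_y hij)
      (commute_x_y hij.symm).symm (commute_y_y i j) m, kernelElement_mul_x_pow_ne_zero hij m⟩

end SeveralVariables

end OneSidedInverses

theorem mainTheorem4 (K : Type*) [Field K] (n : ℕ) (hn : 1 ≤ n) :
    (IsLeftCoherentRing (OneSidedInverses K n) ↔ IsRightCoherentRing (OneSidedInverses K n)) ∧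
    (IsRightCoherentRing (OneSidedInverses K n) ↔ n = 1) ∧
    (∀ h2 : 2 ≤ n,
      (∃ J : ℕ → Submodule (OneSidedInverses K n) (OneSidedInverses K n),
        (∀ s, J s ≠ ⊥) ∧ iSupIndep J ∧
        ⨆ s, J s = kerMulRight (OneSidedInverses K n)
          (OneSidedInverses.x K ⟨0, by omega⟩ - OneSidedInverses.x K ⟨1, by omega⟩)) ∧
      ¬ (kerMulRight (OneSidedInverses K n)
          (OneSidedInverses.x K ⟨0, by omega⟩ - OneSidedInverses.x K ⟨1, by omega⟩)).FG) := by
  have hne : ∀ h2 : 2 ≤ n, (⟨0, by omega⟩ : Fin n) ≠ ⟨1, by omega⟩ := fun h2 => by simp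
  refine ⟨OneSidedInverses.isLeftCoherentRing_iff_isRightCoherentRing K n, ?_, fun h2 => ⟨?_, ?_⟩⟩
  · rw [← OneSidedInverses.isLeftCoherentRing_iff_isRightCoherentRing]
    constructor
    · intro h
      by_contra h1
      have h2 : 2 ≤ n := by omega
      exact OneSidedInverses.not_fg_kerMulRight_x_sub_x (hne h2) (h.fg_kerMulRight _)
    · rintro rfl
      exact OneSidedInverses.isLeftCoherentRing_one
  · refine ⟨_, fun d h => ?_, OneSidedInverses.iSupIndep_span_kernelElement (hne h2),
      OneSidedInverses.iSup_span_kernelElement (hne h2)⟩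
    apply OneSidedInverses.kernelElement_mul_x_pow_ne_zero (K := K) (hne h2) d
    rw [Submodule.span_singleton_eq_bot.1 h, zero_mul]
  · exact OneSidedInverses.not_fg_kerMulRight_x_sub_x (hne h2)
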